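/- **Setting.** A censored $d$-armed bandit has mean rewards $\theta^\star\in\mathbb{R}^d$ and realization probabilities $p_a\in(0,1]$, $a\in[d]$. In each round $t=1,\dots,T$ a nonempty action set $\mathcal{A}_t\subseteq[d]$ (a sequence fixed in advance) is shown, the agent plays an arm $a_t\in\mathcal{A}_t$ on the basis of the past (and possibly own randomization), and then a censorship variable $x_t\in\{0,1\}$ is drawn which, given the past and $a_t$, is Bernoulli with parameter $p_{a_t}$. The feedback $\theta^\star_{a_t}+\epsilon_t$ is observed if and only if $x_t=1$. The noise $\epsilon_t$ is independent of the past, of $a_t$ and of $x_t$, and is sub-Gaussian with variance proxy $\sigma^2$, i.e. $\mathbb{E}[e^{s\epsilon_t}]\le e^{\sigma^2s^2/2}$ for all $s\in\mathbb{R}$. The pseudo-regret is $R(T)=\sum_{t=1}^T\bigl(\max_{a\in\mathcal{A}_t}\theta^\star_a-\theta^\star_{a_t}\bigr)$, and the effective dimension is $d_{\mathrm{eff}}=\sum_{a\in[d]}1/p_a$. **Algorithm.** With $N_a(t)=\sum_{s\le t}\mathbf{1}\{a_s=a,\,x_s=1\}$, the UCB algorithm with regularization $\lambda>0$ plays, in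 every round $t\le T$, an arm $a_t\in\mathcal{A}_t$ (ties broken in any way) that maximizes over $a\in\mathcal{A}_t$ the index $$\frac{\sum_{s\le t-1}(\theta^\star_{a_s}+\epsilon_s)\mathbf{1}\{a_s=a,\,x_s=1\}}{N_a(t-1)+\lambda}+\sqrt{\frac{6\sigma^2\log T}{\lambda+N_a(t-1)}}+\frac{\lambda\|\theta^\star\|_\infty}{\lambda+N_a(t-1)}.$$ **Theorem.** There is a universal constant $C>0$ with the following two properties. 1. For all $d$, all $p\in(0,1]^d$, $\theta^\star\in\mathbb{R}^d$, $\sigma\ge0$, $\lambda>0$, $T\ge2$, and all nonempty action sets, the expected pseudo-regret of the UCB algorithm with regularization $\lambda$ satisfies $$\mathbb{E}[R(T)]\le C\Bigl(\sigma\sqrt{d_{\mathrm{eff}}\,T\log T}+d_{\mathrm{eff}}\,\|\theta^\star\|_\infty\bigl(\log T+\lambda\log(1+T/\lambda)\bigr)\Bigr).$$ 2. Let $\sigma>0$, $M,D\in\mathbb{R}$, and let the regularizations $\lambda_T>0$ satisfy $\lambda_T=o(\log T)$ as $T\to\infty$ (for instance, $\lambda_T$ constant). Then there is $T_0$, depending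 only on $\sigma$, $M$, $D$ and the sequence $(\lambda_T)$, such that for all $T\ge T_0$ and all censored bandits with $d_{\mathrm{eff}}\le D$ and $\|\theta^\star\|_\infty\le M$, the UCB algorithm with horizon $T$ and regularization $\lambda_T$ satisfies $$\mathbb{E}[R(T)]\le C\,\sigma\sqrt{d_{\mathrm{eff}}\,T\log T}.$$ Thus the expected pseudo-regret is $\tilde{\mathcal{O}}(\sigma\sqrt{d_{\mathrm{eff}}T})$ to leading order, with no dependence on the gaps. This is the bound of the uncensored case $p\equiv1$, where $d_{\mathrm{eff}}=d$, with $d_{\mathrm{eff}}$ in place of $d$. -/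

import Mathlib

open MeasureTheory ProbabilityTheory Filter
open scoped NNReal Asymptotics

namespace CensoredBandit

/-- The effective dimension `∑ₐ 1 / pₐ` of a censored bandit in which the feedback of arm `a`
is realized with probability `p a`. -/
noncomputable def effDim {d : ℕ} (p : Fin d → ℝ) : ℝ := ∑ a, 1 / p a

/-- The interaction of an agent with a censored `d`-armed bandit during `T` rounds, numbered
`0, …, T - 1`. The σ-algebra `ℱ t` describes everything that is settled when the arm of round `t`
is chosen: the past, and any additional randomization of the agent. In round `t` the agent plays
`arm t` from the action set `𝒜 t`; the feedback carries the noise `ε t` and is realized (observed)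
iff `x t = true`. -/
structure IsCensoredRun {Ω : Type*} [mΩ : MeasurableSpace Ω] (μ : Measure Ω)
    (ℱ : Filtration ℕ mΩ) {d : ℕ} (𝒜 : ℕ → Finset (Fin d))
    (p : Fin d → ℝ) (σ : ℝ≥0) (T : ℕ)
    (arm : ℕ → Ω → Fin d) (x : ℕ → Ω → Bool) (ε : ℕ → Ω → ℝ) : Prop where
  /-- only available arms are played -/
  arm_mem : ∀ t < T, ∀ ω, arm t ω ∈ 𝒜 t
  /-- the arm is chosen before the censorship and the noise of the round are drawn -/
  arm_meas : ∀ t < T, Measurable[ℱ t] (arm t)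
  x_meas : ∀ t < T, Measurable[ℱ (t + 1)] (x t)
  ε_meas : ∀ t < T, Measurable[ℱ (t + 1)] (ε t)
  /-- given the past and the chosen arm, the censorship variable is Bernoulli with the
  parameter of that arm -/
  x_bernoulli : ∀ t < T,
    μ[fun ω ↦ if x t ω = true then (1 : ℝ) else 0 | ℱ t] =ᵐ[μ] fun ω ↦ p (arm t ω)
  /-- the noise is independent of the past and of the current arm and censorship variable; in
  particular the noise variables are independent of each other -/
  ε_indep : ∀ t < T,
    Indep (ℱ t ⊔ MeasurableSpace.comap (x t) inferInstance)
      (MeasurableSpace.comap (ε t) inferInstance) μ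
  /-- the noise is (centered and) sub-Gaussian with variance proxy `σ ^ 2` -/
  ε_subgaussian : ∀ t < T, HasSubgaussianMGF (ε t) (σ ^ 2) μ

/-- The rounds before round `t` in which arm `a` was played and its feedback was realized. -/
def realizedRounds {Ω : Type*} {d : ℕ} (arm : ℕ → Ω → Fin d) (x : ℕ → Ω → Bool)
    (a : Fin d) (t : ℕ) (ω : Ω) : Finset ℕ :=
  {s ∈ Finset.range t | arm s ω = a ∧ x s ω = true}

/-- The number of realizations of arm `a` before round `t`. -/
def numRealized {Ω : Type*} {d : ℕ} (arm : ℕ → Ω → Fin d) (x : ℕ → Ω → Bool)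
    (a : Fin d) (t : ℕ) (ω : Ω) : ℕ :=
  (realizedRounds arm x a t ω).card

/-- The regularized empirical mean of arm `a`, computed from the feedback `θ (arm s) + ε s` that
was realized before round `t`. -/
noncomputable def regMean {Ω : Type*} {d : ℕ} (θ : Fin d → ℝ) (lam : ℝ)
    (arm : ℕ → Ω → Fin d) (x : ℕ → Ω → Bool) (ε : ℕ → Ω → ℝ)
    (a : Fin d) (t : ℕ) (ω : Ω) : ℝ :=
  (∑ s ∈ realizedRounds arm x a t ω, (θ (arm s ω) + ε s ω)) / (numRealized arm x a t ω + lam)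

/-- The optimistic reward estimator of the UCB algorithm with regularization `lam` and horizon
`T`. The norm on `Fin d → ℝ` is the sup norm. -/
noncomputable def ucbIndex {Ω : Type*} {d : ℕ} (θ : Fin d → ℝ) (σ : ℝ≥0) (lam : ℝ) (T : ℕ)
    (arm : ℕ → Ω → Fin d) (x : ℕ → Ω → Bool) (ε : ℕ → Ω → ℝ)
    (a : Fin d) (t : ℕ) (ω : Ω) : ℝ :=
  regMean θ lam arm x ε a t ω
    + √(6 * (σ : ℝ) ^ 2 * Real.log T / (lam + numRealized arm x a t ω))
    + lam * ‖θ‖ / (lam + numRealized arm x a t ω)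

/-- The agent follows the UCB algorithm: in each round the arm played maximizes the optimistic
reward estimator over the action set. Ties may be broken in any way. -/
def IsUCB {Ω : Type*} {d : ℕ} (𝒜 : ℕ → Finset (Fin d)) (θ : Fin d → ℝ) (σ : ℝ≥0) (lam : ℝ)
    (T : ℕ) (arm : ℕ → Ω → Fin d) (x : ℕ → Ω → Bool) (ε : ℕ → Ω → ℝ) : Prop :=
  ∀ t < T, ∀ ω, ∀ b ∈ 𝒜 t,
    ucbIndex θ σ lam T arm x ε b t ω ≤ ucbIndex θ σ lam T arm x ε (arm t ω) t ω

/-- The pseudo-regret over `T` rounds, a bounded random variable. -/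
noncomputable def pseudoRegret {Ω : Type*} {d : ℕ} (𝒜 : ℕ → Finset (Fin d))
    (h𝒜 : ∀ t, (𝒜 t).Nonempty) (θ : Fin d → ℝ) (T : ℕ) (arm : ℕ → Ω → Fin d) (ω : Ω) : ℝ :=
  ∑ t ∈ Finset.range T, ((𝒜 t).sup' (h𝒜 t) θ - θ (arm t ω))

end CensoredBandit

/-!
The index of the played arm is at least that of the best available arm. As long as every confidence
interval is valid, the regret of a round is therefore at most twice the confidence width of the arm
played (`IsUCB.sub_le`), which depends on the past only through the number `N` of realizations of
this arm.

*Validity of the confidence intervals.* For every real `s`, the process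
`exp (s * S - s ^ 2 * σ ^ 2 / 2 * N)`, where `S` is the noise accumulated by an arm, is a
supermartingale (`IsCensoredRun.lintegral_exp_noiseSum_le_one`), because the noise of a round is
independent of the arm and of the censorship. Chernoff's bound for each possible value of `N` and a
union bound show that invalid intervals cost only `O(d * ‖θ‖)` in total.

*Censorship.* Given the past and that arm `a` is played, its feedback is realized with probability
`p a`. Hence the expected sum of the widths over the plays of `a` is `1 / p a` times the expected
sum over its realizations (`IsCensoredRun.integral_sum_play_eq`). Along the realizations `N` runs
through `0, 1, 2, …`, so the latter sum is the deterministic quantity bounded in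
`sum_min_confWidth_le`, of order `σ * √(N * log T) + ‖θ‖ * (1 + lam * log (1 + T / lam))` with `N`
the final number of realizations. No concentration of the censorship variables is needed. Applied to
constant widths, the same identity says that the expected values of `N / p a` add up to `T`
(`IsCensoredRun.sum_integral_numRealized`), which turns the weighted sum of the `√N` into
`√(effDim p * T)`.

For large horizons, `log (1 + y) ≤ 2 * √y` shows that `lam = o(log T)` makes the remaining terms
`o(√(T * log T))` (`eventually_lowerOrder_le`).
-/

namespace CensoredBandit

/-! ### Counting realizations -/

/-- The sum of the noise in the feedback of arm `a` that was realized before round `t`. -/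
noncomputable def noiseSum {Ω : Type*} {d : ℕ} (arm : ℕ → Ω → Fin d) (x : ℕ → Ω → Bool)
    (ε : ℕ → Ω → ℝ) (a : Fin d) (t : ℕ) (ω : Ω) : ℝ :=
  ∑ s ∈ realizedRounds arm x a t ω, ε s ω

section Counting

variable {Ω : Type*} {d : ℕ} (arm : ℕ → Ω → Fin d) (x : ℕ → Ω → Bool) (ε : ℕ → Ω → ℝ)
  (a : Fin d)

lemma numRealized_zero (ω : Ω) : numRealized arm x a 0 ω = 0 := by
  simp [numRealized, realizedRounds]

lemma noiseSum_zero (ω : Ω) : noiseSum arm x ε a 0 ω = 0 := by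
  simp [noiseSum, realizedRounds]

open Classical in
lemma numRealized_succ (t : ℕ) (ω : Ω) :
    numRealized arm x a (t + 1) ω =
      numRealized arm x a t ω + if arm t ω = a ∧ x t ω = true then 1 else 0 := by
  unfold numRealized realizedRounds
  rw [Finset.range_add_one, Finset.filter_insert]
  split_ifs <;> simp

open Classical in
lemma noiseSum_succ (t : ℕ) (ω : Ω) :
    noiseSum arm x ε a (t + 1) ω =
      noiseSum arm x ε a t ω + if arm t ω = a ∧ x t ω = true then ε t ω else 0 := by
  unfold noiseSum realizedRounds
  rw [Finset.range_add_one, Finset.filter_insert]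
  split_ifs
  · rw [Finset.sum_insert (by simp), add_comm]
  · simp

lemma numRealized_le (t : ℕ) (ω : Ω) : numRealized arm x a t ω ≤ t := by
  simpa [numRealized, realizedRounds] using
    Finset.card_filter_le (Finset.range t) (fun s ↦ arm s ω = a ∧ x s ω = true)

lemma noiseSum_eq_zero {t : ℕ} {ω : Ω} (h : numRealized arm x a t ω = 0) :
    noiseSum arm x ε a t ω = 0 := by
  rw [numRealized, Finset.card_eq_zero] at h
  simp [noiseSum, h]

open Classical in
/-- The realizations of an arm step through its counter one unit at a time: a sum over them of a
function of the counter is a sum over an initial segment of `ℕ`. -/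
lemma sum_realized_eq_sum_range (g : ℕ → ℝ) (t : ℕ) (ω : Ω) :
    ∑ s ∈ Finset.range t,
        (if arm s ω = a ∧ x s ω = true then g (numRealized arm x a s ω) else 0) =
      ∑ n ∈ Finset.range (numRealized arm x a t ω), g n := by
  induction t with
  | zero => simp [numRealized_zero]
  | succ t ih =>
    rw [Finset.sum_range_succ, ih, numRealized_succ]
    split_ifs
    · rw [Finset.sum_range_succ]
    · simp

/-- The regularized mean misses the mean by the averaged noise and a bias of the
regularization. -/
lemma regMean_sub {θ : Fin d → ℝ} {lam : ℝ} (hlam : 0 < lam) (t : ℕ) (ω : Ω) :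
    regMean θ lam arm x ε a t ω - θ a =
      (noiseSum arm x ε a t ω - lam * θ a) / (lam + numRealized arm x a t ω) := by
  have h : ∑ s ∈ realizedRounds arm x a t ω, (θ (arm s ω) + ε s ω) =
      numRealized arm x a t ω * θ a + noiseSum arm x ε a t ω := by
    rw [Finset.sum_add_distrib, noiseSum, numRealized, ← nsmul_eq_mul, ← Finset.sum_const]
    congr 1
    refine Finset.sum_congr rfl fun s hs ↦ ?_
    rw [(Finset.mem_filter.1 hs).2.1]
  have h0 : lam + (numRealized arm x a t ω : ℝ) ≠ 0 := by positivity
  rw [regMean, h, add_comm _ lam]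
  field_simp
  ring

end Counting

/-! ### Concentration of the noise -/

/-- Multiplying a nonnegative function, on a set settled together with it, by an independent factor
of mean at most one does not increase its integral. -/
lemma lintegral_compl_indicator_add_mul_le {Ω : Type*} {m₁ m₂ mΩ : MeasurableSpace Ω}
    {μ : Measure Ω} (h₁ : m₁ ≤ mΩ) (h₂ : m₂ ≤ mΩ) (hind : Indep m₁ m₂ μ)
    {M Z : Ω → ENNReal} {R : Set Ω} (hM : Measurable[m₁] M) (hR : MeasurableSet[m₁] R)
    (hZ : Measurable[m₂] Z) (hZ1 : ∫⁻ ω, Z ω ∂μ ≤ 1) :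
    ∫⁻ ω, (Rᶜ.indicator M ω + R.indicator M ω * Z ω) ∂μ ≤ ∫⁻ ω, M ω ∂μ := by
  have hMR : Measurable[mΩ] (Rᶜ.indicator M) := (hM.mono h₁ le_rfl).indicator (h₁ _ hR).compl
  rw [lintegral_add_left hMR,
    lintegral_mul_eq_lintegral_mul_lintegral_of_independent_measurableSpace h₁ h₂
      hind (hM.indicator hR) hZ]
  calc _ ≤ ∫⁻ ω, Rᶜ.indicator M ω ∂μ + ∫⁻ ω, R.indicator M ω ∂μ :=
        add_le_add le_rfl (mul_le_of_le_one_right' hZ1)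
    _ = ∫⁻ ω, M ω ∂μ := by
        rw [← lintegral_add_left hMR]
        congr 1
        ext ω
        rw [add_comm]
        exact congrFun (Set.indicator_self_add_compl R M) ω

namespace IsCensoredRun

variable {Ω : Type*} {mΩ : MeasurableSpace Ω} {μ : Measure Ω}
  {ℱ : Filtration ℕ mΩ} {d : ℕ} {𝒜 : ℕ → Finset (Fin d)} {p : Fin d → ℝ} {σ : ℝ≥0} {T : ℕ}
  {arm : ℕ → Ω → Fin d} {x : ℕ → Ω → Bool} {ε : ℕ → Ω → ℝ}

lemma measurableSet_realized (h : IsCensoredRun μ ℱ 𝒜 p σ T arm x ε) (a : Fin d) {t : ℕ}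
    (ht : t < T) :
    MeasurableSet[ℱ t ⊔ MeasurableSpace.comap (x t) inferInstance]
      {ω | arm t ω = a ∧ x t ω = true} := by
  refine MeasurableSet.inter ?_ ?_
  · exact le_sup_left (a := ℱ t) _ (h.arm_meas t ht (measurableSet_singleton a))
  · exact le_sup_right (a := ℱ t) _ ⟨{true}, measurableSet_singleton _, rfl⟩

lemma sup_comap_le (h : IsCensoredRun μ ℱ 𝒜 p σ T arm x ε) {t : ℕ} (ht : t < T) :
    ℱ t ⊔ MeasurableSpace.comap (x t) inferInstance ≤ ℱ (t + 1) :=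
  sup_le (ℱ.mono t.le_succ) (h.x_meas t ht).comap_le

lemma measurable_numRealized (h : IsCensoredRun μ ℱ 𝒜 p σ T arm x ε) (a : Fin d) {t : ℕ}
    (ht : t ≤ T) : Measurable[ℱ t] (numRealized arm x a t) := by
  classical
  induction t with
  | zero =>
    rw [funext (numRealized_zero arm x a)]
    exact measurable_const
  | succ t ih =>
    rw [funext (numRealized_succ arm x a t)]
    exact ((ih (by omega)).mono (ℱ.mono t.le_succ) le_rfl).add
      (Measurable.ite (h.sup_comap_le ht _ (h.measurableSet_realized a ht))
        measurable_const measurable_const)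

lemma measurable_noiseSum (h : IsCensoredRun μ ℱ 𝒜 p σ T arm x ε) (a : Fin d) {t : ℕ}
    (ht : t ≤ T) : Measurable[ℱ t] (noiseSum arm x ε a t) := by
  classical
  induction t with
  | zero =>
    rw [funext (noiseSum_zero arm x ε a)]
    exact measurable_const
  | succ t ih =>
    rw [funext (noiseSum_succ arm x ε a t)]
    exact ((ih (by omega)).mono (ℱ.mono t.le_succ) le_rfl).add
      (Measurable.ite (h.sup_comap_le ht _ (h.measurableSet_realized a ht))
        (h.ε_meas t ht) measurable_const)

/-- The exponential supermartingale of the noise of an arm, run on the clock of its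
realizations. -/
lemma lintegral_exp_noiseSum_le_one [IsProbabilityMeasure μ]
    (h : IsCensoredRun μ ℱ 𝒜 p σ T arm x ε) (a : Fin d) (s : ℝ)
    {t : ℕ} (ht : t ≤ T) :
    ∫⁻ ω, ENNReal.ofReal (Real.exp (s * noiseSum arm x ε a t ω
      - s ^ 2 * σ ^ 2 / 2 * numRealized arm x a t ω)) ∂μ ≤ 1 := by
  classical
  induction t with
  | zero => simp [numRealized_zero, noiseSum_zero]
  | succ t ih =>
    refine le_trans ?_ (ih (by omega))
    set M : Ω → ENNReal := fun ω ↦ ENNReal.ofReal (Real.exp (s * noiseSum arm x ε a t ω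
      - s ^ 2 * σ ^ 2 / 2 * numRealized arm x a t ω)) with hM
    have hMm : Measurable[ℱ t] M := by
      have h1 := h.measurable_noiseSum a (t := t) (by omega)
      have h2 := h.measurable_numRealized a (t := t) (by omega)
      have h3 : Measurable[ℱ t] fun ω ↦ (numRealized arm x a t ω : ℝ) :=
        measurable_from_top.comp h2
      exact ENNReal.measurable_ofReal.comp
        (Real.measurable_exp.comp ((h1.const_mul s).sub (h3.const_mul _)))
    set R : Set Ω := {ω | arm t ω = a ∧ x t ω = true} with hR
    set Z : Ω → ENNReal := fun ω ↦
      ENNReal.ofReal (Real.exp (s * ε t ω - s ^ 2 * σ ^ 2 / 2)) with hZ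
    have hZm : Measurable[MeasurableSpace.comap (ε t) inferInstance] Z := by
      have h1 : Measurable[MeasurableSpace.comap (ε t) inferInstance] (ε t) :=
        comap_measurable _
      exact ENNReal.measurable_ofReal.comp
        (Real.measurable_exp.comp ((h1.const_mul s).sub_const _))
    have hεle : MeasurableSpace.comap (ε t) inferInstance ≤ mΩ :=
      ((h.ε_meas t ht).mono (ℱ.le _) le_rfl).comap_le
    have hZ1 : ∫⁻ ω, Z ω ∂μ ≤ 1 := by
      have hsg := h.ε_subgaussian t ht
      have hmgf := hsg.mgf_le s
      have hint := hsg.integrable_exp_mul s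
      have : ∀ ω, Real.exp (s * ε t ω - s ^ 2 * σ ^ 2 / 2) =
          Real.exp (s * ε t ω) * Real.exp (- (s ^ 2 * σ ^ 2 / 2)) := fun ω ↦ by
        rw [← Real.exp_add, sub_eq_add_neg]
      simp only [hZ, this]
      rw [← ofReal_integral_eq_lintegral_ofReal (hint.mul_const _)
        (ae_of_all _ fun ω ↦ by positivity), integral_mul_const]
      rw [ENNReal.ofReal_le_one]
      calc _ ≤ Real.exp (((σ ^ 2 : ℝ≥0) : ℝ) * s ^ 2 / 2) * Real.exp (- (s ^ 2 * σ ^ 2 / 2)) :=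
            mul_le_mul_of_nonneg_right hmgf (Real.exp_nonneg _)
        _ = 1 := by
            rw [← Real.exp_add]
            push_cast
            rw [Real.exp_eq_one_iff]
            ring
    have key : ∀ ω, ENNReal.ofReal (Real.exp (s * noiseSum arm x ε a (t + 1) ω
        - s ^ 2 * σ ^ 2 / 2 * numRealized arm x a (t + 1) ω)) =
        Rᶜ.indicator M ω + R.indicator M ω * Z ω := fun ω ↦ by
      rw [noiseSum_succ, numRealized_succ]
      by_cases hω : arm t ω = a ∧ x t ω = true
      · have hω' : ω ∈ R := hω
        simp only [hω, hω', and_self, if_true, Set.indicator_of_mem,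
          Set.mem_compl_iff, not_true_eq_false, not_false_eq_true, Set.indicator_of_notMem,
          zero_add, hM, hZ]
        rw [← ENNReal.ofReal_mul (Real.exp_nonneg _), ← Real.exp_add]
        congr 2
        push_cast
        ring
      · have hω' : ω ∉ R := hω
        simp [hω, hω', hM]
    simp only [key]
    exact lintegral_compl_indicator_add_mul_le ((h.sup_comap_le ht).trans (ℱ.le _)) hεle
      (h.ε_indep t ht) (hMm.mono le_sup_left le_rfl) (h.measurableSet_realized a ht) hZm hZ1

lemma noise_ae_eq_zero (h : IsCensoredRun μ ℱ 𝒜 p 0 T arm x ε) (a : Fin d) {t : ℕ}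
    (ht : t ≤ T) : ∀ᵐ ω ∂μ, noiseSum arm x ε a t ω = 0 := by
  have h0 : ∀ᵐ ω ∂μ, ∀ s, s < T → ε s ω = 0 := by
    refine ae_all_iff.2 fun s ↦ ?_
    by_cases hs : s < T
    · have h1 := h.ε_subgaussian s hs
      rw [zero_pow two_ne_zero] at h1
      filter_upwards [h1.ae_eq_zero_of_hasSubgaussianMGF_zero] with ω hω _ using hω
    · exact ae_of_all _ fun ω hs' ↦ absurd hs' hs
  filter_upwards [h0] with ω hω
  refine Finset.sum_eq_zero fun s hs ↦ hω s ?_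
  have := Finset.mem_range.1 (Finset.mem_filter.1 hs).1
  omega

/-- Chernoff's bound for the noise of an arm after exactly `n` realizations; both tails are
covered by one application of Markov's inequality to a sum of two exponentials. -/
lemma measure_sq_noiseSum_gt_le [IsProbabilityMeasure μ]
    (h : IsCensoredRun μ ℱ 𝒜 p σ T arm x ε) (hσ : 0 < σ) (a : Fin d) {t n : ℕ}
    (ht : t ≤ T) (hn : 0 < n) {c : ℝ} (hc : 0 ≤ c) :
    μ {ω | numRealized arm x a t ω = n ∧ 2 * σ ^ 2 * c * n < noiseSum arm x ε a t ω ^ 2} ≤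
      ENNReal.ofReal (2 * Real.exp (-c)) := by
  set r := √(2 * σ ^ 2 * c * n) with hr
  have hσ' : (0 : ℝ) < σ := hσ
  have hn' : (0 : ℝ) < n := by exact_mod_cast hn
  have hr2 : r ^ 2 = 2 * σ ^ 2 * c * n := Real.sq_sqrt (by positivity)
  have hr0 : 0 ≤ r := Real.sqrt_nonneg _
  -- The minimizer of the exponent `-s * r + s ^ 2 * σ ^ 2 / 2 * n` in Chernoff's bound.
  set s := r / (σ ^ 2 * n) with hs
  have hs0 : 0 ≤ s := by positivity
  set F : ℝ → Ω → ENNReal := fun s ω ↦ ENNReal.ofReal (Real.exp (s * noiseSum arm x ε a t ω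
      - s ^ 2 * σ ^ 2 / 2 * numRealized arm x a t ω)) with hF
  have hFm : ∀ s, Measurable (F s) := fun s ↦ by
    have h1 := (h.measurable_noiseSum a ht).mono (ℱ.le _) le_rfl
    have h2 := (h.measurable_numRealized a ht).mono (ℱ.le _) le_rfl
    have h3 : Measurable fun ω ↦ (numRealized arm x a t ω : ℝ) :=
      measurable_from_top.comp h2
    exact ENNReal.measurable_ofReal.comp
      (Real.measurable_exp.comp ((h1.const_mul s).sub (h3.const_mul _)))
  have hint : ∫⁻ ω, (F s ω + F (-s) ω) ∂μ ≤ 2 := by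
    rw [lintegral_add_left (hFm s)]
    refine (add_le_add (h.lintegral_exp_noiseSum_le_one a s ht)
      (h.lintegral_exp_noiseSum_le_one a (-s) ht)).trans ?_
    norm_num
  have hsub : {ω | numRealized arm x a t ω = n ∧
      2 * σ ^ 2 * c * n < noiseSum arm x ε a t ω ^ 2} ⊆
      {ω | ENNReal.ofReal (Real.exp c) ≤ F s ω + F (-s) ω} := by
    rintro ω ⟨hN, hS⟩
    have hcr : s * r - s ^ 2 * σ ^ 2 / 2 * n = c := by
      have : s * r - s ^ 2 * σ ^ 2 / 2 * n = r ^ 2 / (2 * σ ^ 2 * n) := by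
        rw [hs]; field_simp; ring
      rw [this, hr2]; field_simp
    rw [← hr2] at hS
    have habs : r < |noiseSum arm x ε a t ω| := by
      rw [← abs_of_nonneg hr0]
      exact sq_lt_sq.1 hS
    have hF' : ∀ u, F u ω = ENNReal.ofReal (Real.exp (u * noiseSum arm x ε a t ω
        - u ^ 2 * σ ^ 2 / 2 * n)) := fun u ↦ by simp only [hF, hN]
    rw [Set.mem_ofPred_eq]
    rcases lt_abs.1 habs with h1 | h1
    · refine le_trans ?_ le_self_add
      rw [hF']
      refine ENNReal.ofReal_le_ofReal (Real.exp_le_exp.2 ?_)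
      rw [← hcr]
      gcongr
    · refine le_trans ?_ le_add_self
      rw [hF']
      refine ENNReal.ofReal_le_ofReal (Real.exp_le_exp.2 ?_)
      rw [← hcr, neg_sq, neg_mul_comm]
      gcongr
  calc _ ≤ μ {ω | ENNReal.ofReal (Real.exp c) ≤ F s ω + F (-s) ω} := measure_mono hsub
    _ ≤ (∫⁻ ω, (F s ω + F (-s) ω) ∂μ) / ENNReal.ofReal (Real.exp c) :=
        meas_ge_le_lintegral_div ((hFm s).add (hFm (-s))).aemeasurable
          (by simp [Real.exp_pos]) ENNReal.ofReal_ne_top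
    _ ≤ 2 / ENNReal.ofReal (Real.exp c) := ENNReal.div_le_div_right hint _
    _ = _ := by
        rw [Real.exp_neg, ← div_eq_mul_inv, ENNReal.ofReal_div_of_pos (Real.exp_pos _)]
        simp

/-- The confidence interval of an arm fails in a given round with probability at most `2 / T ^ 2`:
Chernoff's bound costs `2 / T ^ 3` for each of the at most `T` possible numbers of
realizations. -/
lemma measureReal_noiseSum_large_le [IsProbabilityMeasure μ]
    (h : IsCensoredRun μ ℱ 𝒜 p σ T arm x ε) {lam : ℝ} (hlam : 0 < lam) (hT : 2 ≤ T)
    (a : Fin d) {t : ℕ} (ht : t < T) :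
    μ.real {ω | 6 * (σ : ℝ) ^ 2 * Real.log T * (lam + numRealized arm x a t ω) <
      noiseSum arm x ε a t ω ^ 2} ≤ 2 / (T : ℝ) ^ 2 := by
  have hT' : (0 : ℝ) < T := by positivity
  have hL : 0 ≤ Real.log T := Real.log_natCast_nonneg T
  refine ENNReal.toReal_le_of_le_ofReal (by positivity) ?_
  -- For `σ = 0` the event is null; the exponent optimized in Chernoff's bound needs `σ ≠ 0`.
  rcases eq_or_ne σ 0 with rfl | hσ
  · refine le_of_eq_of_le ?_ zero_le
    have h0 := h.noise_ae_eq_zero a ht.le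
    rw [ae_iff] at h0
    refine measure_mono_null (fun ω hω ↦ ?_) h0
    rw [Set.mem_ofPred_eq] at hω ⊢
    intro h1
    simp [h1] at hω
  have hσ0 : 0 < σ := pos_iff_ne_zero.2 hσ
  have hsub : {ω | 6 * (σ : ℝ) ^ 2 * Real.log T * (lam + numRealized arm x a t ω) <
      noiseSum arm x ε a t ω ^ 2} ⊆ ⋃ n ∈ Finset.Ioo 0 T,
      {ω | numRealized arm x a t ω = n ∧
        2 * (σ : ℝ) ^ 2 * (3 * Real.log T) * n < noiseSum arm x ε a t ω ^ 2} := by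
    intro ω hω
    rw [Set.mem_ofPred_eq] at hω
    have hle := numRealized_le arm x a t ω
    have hpos : 0 < numRealized arm x a t ω := by
      rw [Nat.pos_iff_ne_zero]
      intro h0
      rw [noiseSum_eq_zero arm x ε a h0] at hω
      have : 0 ≤ 6 * (σ : ℝ) ^ 2 * Real.log T * (lam + numRealized arm x a t ω) := by positivity
      linarith
    simp only [Set.mem_iUnion]
    refine ⟨numRealized arm x a t ω, Finset.mem_Ioo.2 ⟨hpos, by omega⟩, rfl, lt_of_le_of_lt ?_ hω⟩
    have : 0 ≤ 6 * (σ : ℝ) ^ 2 * Real.log T * lam := by positivity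
    nlinarith
  calc _ ≤ ∑ n ∈ Finset.Ioo 0 T, μ {ω | numRealized arm x a t ω = n ∧
        2 * (σ : ℝ) ^ 2 * (3 * Real.log T) * n < noiseSum arm x ε a t ω ^ 2} :=
        (measure_mono hsub).trans (measure_biUnion_finset_le _ _)
    _ ≤ ∑ n ∈ Finset.Ioo 0 T, ENNReal.ofReal (2 * Real.exp (-(3 * Real.log T))) :=
        Finset.sum_le_sum fun n hn ↦ h.measure_sq_noiseSum_gt_le hσ0 a ht.le
          (Finset.mem_Ioo.1 hn).1 (by positivity)
    _ ≤ ENNReal.ofReal (T * (2 * Real.exp (-(3 * Real.log T)))) := by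
        rw [Finset.sum_const, nsmul_eq_mul, ENNReal.ofReal_mul hT'.le, ENNReal.ofReal_natCast]
        gcongr
        simp
    _ = ENNReal.ofReal (2 / (T : ℝ) ^ 2) := by
        congr 1
        rw [Real.exp_neg, mul_comm 3 (Real.log T), Real.exp_mul, Real.exp_log hT']
        norm_cast
        field_simp
        push_cast
        ring

/-! ### Plays and realizations -/

lemma integrable_comp_numRealized [IsProbabilityMeasure μ]
    (h : IsCensoredRun μ ℱ 𝒜 p σ T arm x ε) (a : Fin d)
    {g : ℕ → ℝ} {B : ℝ} (hg : ∀ n, |g n| ≤ B) {t : ℕ} (ht : t ≤ T) :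
    Integrable (fun ω ↦ g (numRealized arm x a t ω)) μ :=
  Integrable.of_bound ((measurable_from_top.comp
    ((h.measurable_numRealized a ht).mono (ℱ.le _) le_rfl)).aestronglyMeasurable) B
    (ae_of_all _ fun _ ↦ hg _)

lemma measurableSet_arm_eq (h : IsCensoredRun μ ℱ 𝒜 p σ T arm x ε) (a : Fin d) {t : ℕ}
    (ht : t < T) : MeasurableSet[ℱ t] {ω | arm t ω = a} :=
  h.arm_meas t ht (measurableSet_singleton a)

/-- Playing an arm is worth `1 / p a` times realizing its feedback, for every payoff that depends
on the number of earlier realizations. -/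
lemma integral_play_eq [IsProbabilityMeasure μ]
    (h : IsCensoredRun μ ℱ 𝒜 p σ T arm x ε) {a : Fin d} (hp : 0 < p a)
    {g : ℕ → ℝ} {B : ℝ} (hg : ∀ n, |g n| ≤ B) {t : ℕ} (ht : t < T) :
    ∫ ω, {ω | arm t ω = a}.indicator (fun ω ↦ g (numRealized arm x a t ω)) ω ∂μ =
      1 / p a * ∫ ω, {ω | arm t ω = a ∧ x t ω = true}.indicator
        (fun ω ↦ g (numRealized arm x a t ω)) ω ∂μ := by
  set f : Ω → ℝ := {ω | arm t ω = a}.indicator (fun ω ↦ g (numRealized arm x a t ω)) with hf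
  set X : Ω → ℝ := fun ω ↦ if x t ω = true then (1 : ℝ) else 0 with hX
  have hfm : StronglyMeasurable[ℱ t] f := by
    have h1 : Measurable[ℱ t] fun ω ↦ g (numRealized arm x a t ω) :=
      measurable_from_top.comp (h.measurable_numRealized a ht.le)
    exact (h1.indicator (h.measurableSet_arm_eq a ht)).stronglyMeasurable
  have hB : 0 ≤ B := (abs_nonneg _).trans (hg 0)
  have hfb : ∀ ω, ‖f ω‖ ≤ B := fun ω ↦
    (norm_indicator_le_norm_self _ ω).trans (hg _)
  have hXm : Measurable X :=
    Measurable.ite (((h.x_meas t ht).mono (ℱ.le _) le_rfl) (measurableSet_singleton true))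
      measurable_const measurable_const
  have hXi : Integrable X μ := Integrable.of_bound hXm.aestronglyMeasurable 1
    (ae_of_all _ fun ω ↦ by simp only [hX]; split_ifs <;> simp)
  have h1 : ∀ ω, {ω | arm t ω = a ∧ x t ω = true}.indicator
      (fun ω ↦ g (numRealized arm x a t ω)) ω = (f * X) ω := fun ω ↦ by
    by_cases h2 : arm t ω = a <;> by_cases h3 : x t ω = true <;>
      simp [hf, hX, h2, h3]
  have h2 : μ[f * X | ℱ t] =ᵐ[μ] fun ω ↦ p a * f ω := by
    refine (condExp_stronglyMeasurable_mul_of_bound (ℱ.le t) hfm hXi B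
      (ae_of_all _ hfb)).trans ?_
    filter_upwards [h.x_bernoulli t ht] with ω hω
    rw [Pi.mul_apply, hX, hω]
    by_cases h2 : arm t ω = a
    · rw [h2, mul_comm]
    · simp [hf, h2]
  have h3 : ∫ ω, (f * X) ω ∂μ = p a * ∫ ω, f ω ∂μ := by
    rw [← integral_condExp (ℱ.le t), integral_congr_ae h2, integral_const_mul]
  simp only [h1]
  rw [h3]
  field_simp

/-- In expectation, the payoffs `g` of the plays of an arm, evaluated at the number of earlier
realizations, add up to `1 / p a` times the sum of `g` over the realizations of the arm. -/
lemma integral_sum_play_eq [IsProbabilityMeasure μ]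
    (h : IsCensoredRun μ ℱ 𝒜 p σ T arm x ε) {a : Fin d} (hp : 0 < p a)
    {g : ℕ → ℝ} {B : ℝ} (hg : ∀ n, |g n| ≤ B) :
    ∫ ω, ∑ t ∈ Finset.range T, {ω | arm t ω = a}.indicator
        (fun ω ↦ g (numRealized arm x a t ω)) ω ∂μ =
      1 / p a * ∫ ω, ∑ n ∈ Finset.range (numRealized arm x a T ω), g n ∂μ := by
  classical
  have hN := fun t (ht : t ∈ Finset.range T) ↦
    h.integrable_comp_numRealized a hg (Finset.mem_range.1 ht).le
  rw [integral_finsetSum _ fun t ht ↦ (hN t ht).indicator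
      (ℱ.le _ _ (h.measurableSet_arm_eq a (Finset.mem_range.1 ht))),
    Finset.sum_congr rfl fun t ht ↦ h.integral_play_eq hp hg (Finset.mem_range.1 ht),
    ← Finset.mul_sum, ← integral_finsetSum _ fun t ht ↦ (hN t ht).indicator
      (ℱ.le _ _ (h.sup_comap_le (Finset.mem_range.1 ht) _
        (h.measurableSet_realized a (Finset.mem_range.1 ht))))]
  simp only [← sum_realized_eq_sum_range, Set.indicator_apply, Set.mem_ofPred_eq]

/-- Every round counts as one play: the expected numbers of realizations, weighted by the
inverse realization probabilities, add up to the horizon. -/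
lemma sum_integral_numRealized [IsProbabilityMeasure μ]
    (h : IsCensoredRun μ ℱ 𝒜 p σ T arm x ε) (hp : ∀ a, 0 < p a) :
    ∑ a, 1 / p a * ∫ ω, (numRealized arm x a T ω : ℝ) ∂μ = T := by
  classical
  have h1 : ∀ a, 1 / p a * ∫ ω, (numRealized arm x a T ω : ℝ) ∂μ =
      ∑ t ∈ Finset.range T, ∫ ω, {ω | arm t ω = a}.indicator (fun _ ↦ (1 : ℝ)) ω ∂μ :=
    fun a ↦ by
      have := h.integral_sum_play_eq (hp a) (g := fun _ ↦ 1) (B := 1) (by simp)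
      simp only [Finset.sum_const, Finset.card_range, nsmul_eq_mul, mul_one] at this
      rw [← this, integral_finsetSum _ fun t ht ↦ (integrable_const _).indicator
        (ℱ.le _ _ (h.measurableSet_arm_eq a (Finset.mem_range.1 ht)))]
  simp only [h1]
  rw [Finset.sum_comm]
  have h2 : ∀ t ∈ Finset.range T,
      ∑ a, ∫ ω, {ω | arm t ω = a}.indicator (fun _ ↦ (1 : ℝ)) ω ∂μ = 1 := fun t ht ↦ by
    rw [← integral_finsetSum _ fun a _ ↦ (integrable_const _).indicator
      (ℱ.le _ _ (h.measurableSet_arm_eq a (Finset.mem_range.1 ht)))]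
    simp [Set.indicator_apply]
  rw [Finset.sum_congr rfl h2]
  simp

end IsCensoredRun

/-! ### Optimism and confidence widths -/

/-- Half the length of the confidence interval of an arm after `n` realizations: the exploration
bonus and the bias of the regularization. -/
noncomputable def confWidth {d : ℕ} (θ : Fin d → ℝ) (σ : ℝ≥0) (lam : ℝ) (T n : ℕ) : ℝ :=
  √(6 * (σ : ℝ) ^ 2 * Real.log T / (lam + n)) + lam * ‖θ‖ / (lam + n)

lemma confWidth_nonneg {d : ℕ} (θ : Fin d → ℝ) (σ : ℝ≥0) {lam : ℝ} (hlam : 0 < lam) (T n : ℕ) :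
    0 ≤ confWidth θ σ lam T n := by
  unfold confWidth
  positivity

section Optimism

variable {Ω : Type*} {d : ℕ} {arm : ℕ → Ω → Fin d} {x : ℕ → Ω → Bool} {ε : ℕ → Ω → ℝ}
  {θ : Fin d → ℝ} {σ : ℝ≥0} {lam : ℝ} {T t : ℕ} {ω : Ω} {𝒜 : ℕ → Finset (Fin d)}

lemma abs_regMean_sub_le (hlam : 0 < lam) (a : Fin d)
    (hS : noiseSum arm x ε a t ω ^ 2 ≤
      6 * (σ : ℝ) ^ 2 * Real.log T * (lam + numRealized arm x a t ω)) :
    |regMean θ lam arm x ε a t ω - θ a| ≤ confWidth θ σ lam T (numRealized arm x a t ω) := by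
  have h0 : 0 < lam + (numRealized arm x a t ω : ℝ) := by positivity
  rw [regMean_sub arm x ε a hlam, sub_div, confWidth]
  refine (abs_sub _ _).trans (add_le_add ?_ ?_)
  · refine Real.le_sqrt_of_sq_le ?_
    rw [sq_abs, div_pow, div_le_div_iff₀ (by positivity) h0]
    nlinarith
  · rw [abs_div, abs_mul, abs_of_pos h0, abs_of_pos hlam]
    gcongr
    exact norm_le_pi_norm θ a

/-- Optimism: the index of an available arm exceeds its mean, hence so does the index of the arm
played, which in turn exceeds the mean of that arm by at most two widths. -/
lemma IsUCB.sub_le (hU : IsUCB 𝒜 θ σ lam T arm x ε) (hlam : 0 < lam) (ht : t < T)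
    (hS : ∀ a, noiseSum arm x ε a t ω ^ 2 ≤
      6 * (σ : ℝ) ^ 2 * Real.log T * (lam + numRealized arm x a t ω)) {b : Fin d}
    (hb : b ∈ 𝒜 t) :
    θ b - θ (arm t ω) ≤ 2 * confWidth θ σ lam T (numRealized arm x (arm t ω) t ω) := by
  have h1 := (abs_le.1 (abs_regMean_sub_le (θ := θ) hlam b (hS b))).1
  have h2 := (abs_le.1 (abs_regMean_sub_le (θ := θ) hlam (arm t ω) (hS (arm t ω)))).2
  have h3 := hU t ht ω b hb
  simp only [ucbIndex, confWidth] at *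
  linarith

end Optimism

section WidthSum

variable {d : ℕ} (θ : Fin d → ℝ) (σ : ℝ≥0) {lam : ℝ} (T : ℕ)

/-- The regret of a single round is at most `2 * ‖θ‖`; this replaces the confidence width of an arm
without realizations, which is useless when `lam` is small. -/
lemma sum_min_confWidth_succ_le (hlam : 0 < lam) (N : ℕ) :
    ∑ n ∈ Finset.range (N + 1), min (2 * ‖θ‖) (2 * confWidth θ σ lam T n) ≤
      2 * ‖θ‖ + 4 * √(6 * (σ : ℝ) ^ 2 * Real.log T) * √N
        + 2 * ‖θ‖ * (lam * Real.log (1 + N / lam)) := by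
  induction N with
  | zero => simp
  | succ N ih =>
    rw [Finset.sum_range_succ]
    -- Each part of the width is dominated by an increment of the corresponding part of the bound.
    have h1 : confWidth θ σ lam T (N + 1) ≤
        √(6 * (σ : ℝ) ^ 2 * Real.log T) * (2 * (√((N + 1 : ℕ) : ℝ) - √N)) +
        ‖θ‖ * (lam * (Real.log (1 + (N + 1 : ℕ) / lam) - Real.log (1 + N / lam))) := by
      refine add_le_add ?_ ?_
      · rw [Real.sqrt_div' _ (by positivity), div_eq_mul_inv]
        gcongr
        set u := √((N + 1 : ℕ) : ℝ) with hu
        have hu2 : u ^ 2 = N + 1 := by rw [hu, Real.sq_sqrt (by positivity)]; push_cast; rfl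
        have hv2 : √(N : ℝ) ^ 2 = N := Real.sq_sqrt (by positivity)
        have hu0 : 0 < u := by positivity
        calc (√(lam + ((N + 1 : ℕ) : ℝ)))⁻¹ ≤ u⁻¹ := by
              rw [hu]
              gcongr
              linarith
          _ ≤ 2 * (u - √N) := by
              rw [inv_le_iff_one_le_mul₀ hu0]
              nlinarith [sq_nonneg (u - √N)]
      · have hA : 0 < lam + (N : ℝ) := by positivity
        have hB : 0 < lam + ((N + 1 : ℕ) : ℝ) := by positivity
        rw [mul_comm lam, mul_div_assoc]
        gcongr
        rw [div_eq_mul_inv]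
        gcongr
        have e1 : 1 + ((N + 1 : ℕ) : ℝ) / lam = (lam + ((N + 1 : ℕ) : ℝ)) / lam := by field_simp
        have e2 : 1 + (N : ℝ) / lam = (lam + N) / lam := by field_simp
        rw [e1, e2, Real.log_div hB.ne' hlam.ne', Real.log_div hA.ne' hlam.ne',
          sub_sub_sub_cancel_right,
          ← Real.log_div hB.ne' hA.ne']
        refine le_trans (le_of_eq ?_) (Real.one_sub_inv_le_log_of_pos (div_pos hB hA))
        rw [inv_div]
        field_simp
        push_cast
        ring
    have h2 := min_le_right (2 * ‖θ‖) (2 * confWidth θ σ lam T (N + 1))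
    linarith

lemma sum_min_confWidth_le (hlam : 0 < lam) {N : ℕ} (hN : N ≤ T) :
    ∑ n ∈ Finset.range N, min (2 * ‖θ‖) (2 * confWidth θ σ lam T n) ≤
      2 * ‖θ‖ + 4 * √(6 * (σ : ℝ) ^ 2 * Real.log T) * √N
        + 2 * ‖θ‖ * (lam * Real.log (1 + T / lam)) := by
  have hlog : 0 ≤ Real.log (1 + T / lam) := Real.log_nonneg (by
    have : (0 : ℝ) ≤ T / lam := by positivity
    linarith)
  cases N with
  | zero =>
    simp only [Finset.range_zero, Finset.sum_empty]
    positivity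
  | succ N =>
    refine (sum_min_confWidth_succ_le θ σ T hlam N).trans ?_
    gcongr <;> omega

end WidthSum

/-! ### The regret bound -/

lemma sub_le_two_mul_norm {d : ℕ} (θ : Fin d → ℝ) (a b : Fin d) : θ b - θ a ≤ 2 * ‖θ‖ := by
  have h1 := abs_le.1 (norm_le_pi_norm θ a)
  have h2 := abs_le.1 (norm_le_pi_norm θ b)
  linarith [h1.1, h2.2]

lemma natCast_le_effDim {d : ℕ} {p : Fin d → ℝ} (hp : ∀ a, 0 < p a ∧ p a ≤ 1) :
    (d : ℝ) ≤ effDim p := by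
  calc (d : ℝ) = ∑ _a : Fin d, (1 : ℝ) := by simp
    _ ≤ effDim p := Finset.sum_le_sum fun a _ ↦ (one_le_div (hp a).1).2 (hp a).2

section Regret

variable {Ω : Type*} {mΩ : MeasurableSpace Ω} {μ : Measure Ω}
  {ℱ : Filtration ℕ mΩ} {d : ℕ} {𝒜 : ℕ → Finset (Fin d)} {h𝒜 : ∀ t, (𝒜 t).Nonempty}
  {p θ : Fin d → ℝ} {σ : ℝ≥0} {T : ℕ} {lam : ℝ}
  {arm : ℕ → Ω → Fin d} {x : ℕ → Ω → Bool} {ε : ℕ → Ω → ℝ}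

/-- The regret of a round is at most the truncated confidence width of the arm played, unless the
confidence interval of some arm fails. -/
lemma IsUCB.pseudoRegret_le (hU : IsUCB 𝒜 θ σ lam T arm x ε) (hlam : 0 < lam) (ω : Ω) :
    pseudoRegret 𝒜 h𝒜 θ T arm ω ≤
      ∑ a, ((∑ t ∈ Finset.range T, {ω | arm t ω = a}.indicator (fun ω ↦
          min (2 * ‖θ‖) (2 * confWidth θ σ lam T (numRealized arm x a t ω))) ω) +
        ∑ t ∈ Finset.range T, {ω | 6 * (σ : ℝ) ^ 2 * Real.log T *
          (lam + numRealized arm x a t ω) < noiseSum arm x ε a t ω ^ 2}.indicator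
            (fun _ ↦ 2 * ‖θ‖) ω) := by
  classical
  rw [Finset.sum_add_distrib, Finset.sum_comm, Finset.sum_comm (s := Finset.univ),
    ← Finset.sum_add_distrib]
  refine Finset.sum_le_sum fun t ht ↦ ?_
  have ht' := Finset.mem_range.1 ht
  obtain ⟨b, hb, hbe⟩ := Finset.exists_mem_eq_sup' (h𝒜 t) θ
  rw [hbe]
  have hbd := sub_le_two_mul_norm θ (arm t ω) b
  have hsum : ∑ a, {ω | arm t ω = a}.indicator (fun ω ↦
      min (2 * ‖θ‖) (2 * confWidth θ σ lam T (numRealized arm x a t ω))) ω =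
      min (2 * ‖θ‖) (2 * confWidth θ σ lam T (numRealized arm x (arm t ω) t ω)) := by
    simp [Set.indicator_apply]
  have hmin : 0 ≤ min (2 * ‖θ‖)
      (2 * confWidth θ σ lam T (numRealized arm x (arm t ω) t ω)) :=
    le_min (by positivity) (mul_nonneg zero_le_two (confWidth_nonneg θ σ hlam T _))
  have hnn : ∀ a ∈ Finset.univ, 0 ≤ {ω | 6 * (σ : ℝ) ^ 2 * Real.log T *
      (lam + numRealized arm x a t ω) < noiseSum arm x ε a t ω ^ 2}.indicator
        (fun _ ↦ 2 * ‖θ‖) ω := fun a _ ↦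
    Set.indicator_nonneg (fun _ _ ↦ by positivity) _
  rw [hsum]
  by_cases hgood : ∀ a, noiseSum arm x ε a t ω ^ 2 ≤
      6 * (σ : ℝ) ^ 2 * Real.log T * (lam + numRealized arm x a t ω)
  · exact (le_min hbd (hU.sub_le hlam ht' hgood hb)).trans
      (le_add_of_nonneg_right (Finset.sum_nonneg hnn))
  · push Not at hgood
    obtain ⟨a, ha⟩ := hgood
    refine hbd.trans (le_trans ?_ (le_add_of_nonneg_left hmin))
    refine le_trans (le_of_eq ?_) (Finset.single_le_sum hnn (Finset.mem_univ a))
    rw [Set.indicator_of_mem (show ω ∈ {ω | 6 * (σ : ℝ) ^ 2 * Real.log T *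
      (lam + numRealized arm x a t ω) < noiseSum arm x ε a t ω ^ 2} from ha)]

lemma IsCensoredRun.measurableSet_noiseSum_large (h : IsCensoredRun μ ℱ 𝒜 p σ T arm x ε)
    (lam : ℝ) (a : Fin d) {t : ℕ} (ht : t ≤ T) :
    MeasurableSet {ω | 6 * (σ : ℝ) ^ 2 * Real.log T * (lam + numRealized arm x a t ω) <
      noiseSum arm x ε a t ω ^ 2} := by
  have h1 := (h.measurable_noiseSum a ht).mono (ℱ.le _) le_rfl
  have h2 := (h.measurable_numRealized a ht).mono (ℱ.le _) le_rfl
  have h3 : Measurable fun ω ↦ (numRealized arm x a t ω : ℝ) := measurable_from_top.comp h2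
  exact measurableSet_lt ((h3.const_add lam).const_mul _) (h1.pow_const 2)

/-- The contribution of one arm to the expected regret. The square root of its number of
realizations is linearized as `√N ≤ (κ + N / κ) / 2`, so that the sum over the arms can be
taken under the expectation. -/
lemma IsCensoredRun.integral_sum_width_le [IsProbabilityMeasure μ]
    (h : IsCensoredRun μ ℱ 𝒜 p σ T arm x ε) (hlam : 0 < lam) {a : Fin d} (hp : 0 < p a)
    {κ : ℝ} (hκ : 0 < κ) :
    ∫ ω, ∑ t ∈ Finset.range T, {ω | arm t ω = a}.indicator (fun ω ↦
        min (2 * ‖θ‖) (2 * confWidth θ σ lam T (numRealized arm x a t ω))) ω ∂μ ≤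
      1 / p a * (2 * ‖θ‖ + 2 * ‖θ‖ * (lam * Real.log (1 + T / lam)) +
        2 * √(6 * (σ : ℝ) ^ 2 * Real.log T) * κ) +
      2 * √(6 * (σ : ℝ) ^ 2 * Real.log T) / κ *
        (1 / p a * ∫ ω, (numRealized arm x a T ω : ℝ) ∂μ) := by
  set g : ℕ → ℝ := fun n ↦ min (2 * ‖θ‖) (2 * confWidth θ σ lam T n) with hg
  set K := √(6 * (σ : ℝ) ^ 2 * Real.log T) with hK
  have hK0 : 0 ≤ K := Real.sqrt_nonneg _
  set c := 2 * ‖θ‖ + 2 * ‖θ‖ * (lam * Real.log (1 + T / lam)) + 2 * K * κ with hc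
  have hg0 : ∀ n, 0 ≤ g n := fun n ↦
    le_min (by positivity) (mul_nonneg zero_le_two (confWidth_nonneg θ σ hlam T _))
  have hgb : ∀ n, |g n| ≤ 2 * ‖θ‖ := fun n ↦ by
    rw [abs_of_nonneg (hg0 n)]
    exact min_le_left _ _
  have hNi : Integrable (fun ω ↦ (numRealized arm x a T ω : ℝ)) μ :=
    Integrable.of_bound ((measurable_from_top.comp
      ((h.measurable_numRealized a le_rfl).mono (ℱ.le _) le_rfl)).aestronglyMeasurable) T
      (ae_of_all _ fun ω ↦ by simpa using numRealized_le arm x a T ω)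
  rw [h.integral_sum_play_eq hp (g := g) hgb]
  have hpt : ∀ ω, ∑ n ∈ Finset.range (numRealized arm x a T ω), g n ≤
      c + 2 * K / κ * numRealized arm x a T ω := fun ω ↦ by
    refine (sum_min_confWidth_le θ σ T hlam (numRealized_le arm x a T ω)).trans ?_
    set N : ℝ := (numRealized arm x a T ω : ℝ) with hN
    have hN0 : 0 ≤ N := by positivity
    have hs : 2 * √N ≤ κ + N / κ := by
      have h1 : √N ^ 2 = N := Real.sq_sqrt hN0
      rw [← sub_nonneg]
      have : κ + N / κ - 2 * √N = (κ - √N) ^ 2 / κ := by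
        field_simp
        rw [sub_sq, h1]
        ring
      rw [this]
      positivity
    have := mul_le_mul_of_nonneg_left hs (by positivity : 0 ≤ 2 * K)
    rw [hc]
    linear_combination this
  have hint : ∫ ω, ∑ n ∈ Finset.range (numRealized arm x a T ω), g n ∂μ ≤
      c + 2 * K / κ * ∫ ω, (numRealized arm x a T ω : ℝ) ∂μ := by
    calc _ ≤ ∫ ω, (c + 2 * K / κ * numRealized arm x a T ω) ∂μ :=
          integral_mono_of_nonneg (ae_of_all _ fun ω ↦ Finset.sum_nonneg fun n _ ↦ hg0 n)
            ((integrable_const _).add (hNi.const_mul _)) (ae_of_all _ hpt)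
      _ = _ := by
          rw [integral_add (integrable_const _) (hNi.const_mul _), integral_const_mul]
          simp
  refine (mul_le_mul_of_nonneg_left hint (by positivity)).trans (le_of_eq ?_)
  ring

/-- The regret bound with explicit constants. -/
lemma integral_pseudoRegret_le [IsProbabilityMeasure μ]
    (hp : ∀ a, 0 < p a ∧ p a ≤ 1) (hlam : 0 < lam) (hT : 2 ≤ T)
    (h : IsCensoredRun μ ℱ 𝒜 p σ T arm x ε) (hU : IsUCB 𝒜 θ σ lam T arm x ε) :
    ∫ ω, pseudoRegret 𝒜 h𝒜 θ T arm ω ∂μ ≤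
      4 * √(6 * (σ : ℝ) ^ 2 * Real.log T) * √(effDim p * T) +
        effDim p * ‖θ‖ * (4 + 2 * (lam * Real.log (1 + T / lam))) := by
  have hT0 : (0 : ℝ) < T := by positivity
  have hdD := natCast_le_effDim hp
  have hd : 0 < d := (h𝒜 0).choose.pos
  have hD : 0 < effDim p := lt_of_lt_of_le (by exact_mod_cast hd) hdD
  set K := √(6 * (σ : ℝ) ^ 2 * Real.log T) with hK
  set l := lam * Real.log (1 + T / lam) with hl
  set W : Fin d → Ω → ℝ := fun a ω ↦
    ∑ t ∈ Finset.range T, {ω | arm t ω = a}.indicator (fun ω ↦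
          min (2 * ‖θ‖) (2 * confWidth θ σ lam T (numRealized arm x a t ω))) ω with hW
  set B : Fin d → ℕ → Set Ω := fun a t ↦ {ω | 6 * (σ : ℝ) ^ 2 * Real.log T *
          (lam + numRealized arm x a t ω) < noiseSum arm x ε a t ω ^ 2} with hB
  have hBm : ∀ a, ∀ t ∈ Finset.range T, MeasurableSet (B a t) := fun a t ht ↦
    h.measurableSet_noiseSum_large lam a (Finset.mem_range.1 ht).le
  have hg0 : ∀ n, 0 ≤ min (2 * ‖θ‖) (2 * confWidth θ σ lam T n) := fun n ↦
    le_min (by positivity) (mul_nonneg zero_le_two (confWidth_nonneg θ σ hlam T _))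
  have hWi : ∀ a, Integrable (W a) μ := fun a ↦
    integrable_finsetSum _ fun t ht ↦ (h.integrable_comp_numRealized a
      (g := fun n ↦ min (2 * ‖θ‖) (2 * confWidth θ σ lam T n)) (B := 2 * ‖θ‖)
      (fun n ↦ by
        rw [abs_of_nonneg (hg0 n)]
        exact min_le_left _ _) (Finset.mem_range.1 ht).le).indicator
        (ℱ.le _ _ (h.measurableSet_arm_eq a (Finset.mem_range.1 ht)))
  have hBi : ∀ a, ∀ t ∈ Finset.range T,
      Integrable ((B a t).indicator fun _ ↦ 2 * ‖θ‖) μ := fun a t ht ↦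
    (integrable_const _).indicator (hBm a t ht)
  have hbad : ∀ a, ∫ ω, ∑ t ∈ Finset.range T, (B a t).indicator (fun _ ↦ 2 * ‖θ‖) ω ∂μ ≤
      2 * ‖θ‖ := fun a ↦ by
    rw [integral_finsetSum _ (hBi a)]
    calc _ ≤ ∑ t ∈ Finset.range T, 2 / (T : ℝ) ^ 2 * (2 * ‖θ‖) :=
          Finset.sum_le_sum fun t ht ↦ by
            rw [integral_indicator_const _ (hBm a t ht), smul_eq_mul]
            gcongr
            exact h.measureReal_noiseSum_large_le hlam hT a (Finset.mem_range.1 ht)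
      _ = 2 / T * (2 * ‖θ‖) := by
          rw [Finset.sum_const, Finset.card_range, nsmul_eq_mul]
          field_simp
      _ ≤ 1 * (2 * ‖θ‖) := by
          gcongr
          rw [div_le_one hT0]
          exact_mod_cast hT
      _ = 2 * ‖θ‖ := one_mul _
  -- The value of `κ` that balances the two terms of the linearized square root.
  set κ := √(T / effDim p) with hκ
  have hκ0 : 0 < κ := by positivity
  have hκ1 : effDim p * κ = √(effDim p * T) := by
    rw [hκ, eq_comm, Real.sqrt_eq_iff_mul_self_eq (by positivity) (by positivity),
      mul_mul_mul_comm, Real.mul_self_sqrt (by positivity)]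
    field_simp
  have hκ2 : T / κ = √(effDim p * T) := by
    rw [← hκ1, div_eq_iff hκ0.ne', mul_assoc, Real.mul_self_sqrt (by positivity)]
    field_simp
  calc ∫ ω, pseudoRegret 𝒜 h𝒜 θ T arm ω ∂μ
      ≤ ∫ ω, ∑ a, (W a ω + ∑ t ∈ Finset.range T,
          (B a t).indicator (fun _ ↦ 2 * ‖θ‖) ω) ∂μ := by
        refine integral_mono_of_nonneg ?_ ?_ (ae_of_all _ fun ω ↦ hU.pseudoRegret_le hlam ω)
        · exact ae_of_all _ fun ω ↦ Finset.sum_nonneg fun t ht ↦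
            sub_nonneg.2 (Finset.le_sup' θ (h.arm_mem t (Finset.mem_range.1 ht) ω))
        · exact integrable_finsetSum _ fun a _ ↦
            (hWi a).add (integrable_finsetSum _ (hBi a))
    _ = ∑ a, (∫ ω, W a ω ∂μ + ∫ ω, ∑ t ∈ Finset.range T,
          (B a t).indicator (fun _ ↦ 2 * ‖θ‖) ω ∂μ) := by
        have hi : ∀ a ∈ Finset.univ, Integrable (fun ω ↦ W a ω + ∑ t ∈ Finset.range T,
            (B a t).indicator (fun _ ↦ 2 * ‖θ‖) ω) μ := fun a _ ↦
          (hWi a).add (integrable_finsetSum _ (hBi a))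
        rw [integral_finsetSum _ hi]
        exact Finset.sum_congr rfl fun a _ ↦
          integral_add (hWi a) (integrable_finsetSum _ (hBi a))
    _ ≤ ∑ a, ((1 / p a * (2 * ‖θ‖ + 2 * ‖θ‖ * l + 2 * K * κ) +
          2 * K / κ * (1 / p a * ∫ ω, (numRealized arm x a T ω : ℝ) ∂μ)) + 2 * ‖θ‖) :=
        Finset.sum_le_sum fun a _ ↦
          add_le_add (h.integral_sum_width_le hlam (hp a).1 hκ0) (hbad a)
    _ = effDim p * (2 * ‖θ‖ + 2 * ‖θ‖ * l + 2 * K * κ) + 2 * K / κ * T + d * (2 * ‖θ‖) := by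
        rw [Finset.sum_add_distrib, Finset.sum_add_distrib, ← Finset.sum_mul, ← Finset.mul_sum,
          h.sum_integral_numRealized fun a ↦ (hp a).1]
        simp [effDim]
    _ ≤ effDim p * (2 * ‖θ‖ + 2 * ‖θ‖ * l + 2 * K * κ) + 2 * K / κ * T +
          effDim p * (2 * ‖θ‖) := by gcongr
    _ = 2 * K * (effDim p * κ) + 2 * K * (T / κ) +
          effDim p * ‖θ‖ * (4 + 2 * l) := by ring
    _ = _ := by
        rw [hκ1, hκ2]
        ring

end Regret

lemma sqrt_bonus_le (σ : ℝ≥0) {L D T : ℝ} (hD : 0 ≤ D) (hT : 0 ≤ T) :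
    4 * √(6 * (σ : ℝ) ^ 2 * L) * √(D * T) ≤ 10 * (σ * √(D * T * L)) := by
  have h1 : √(6 * (σ : ℝ) ^ 2 * L) = √6 * σ * √L := by
    rw [Real.sqrt_mul (by positivity), Real.sqrt_mul (by positivity),
      Real.sqrt_sq σ.coe_nonneg]
  have h6 : √6 ≤ 5 / 2 := Real.sqrt_le_iff.2 ⟨by norm_num, by norm_num⟩
  rw [h1, Real.sqrt_mul (by positivity) L]
  calc 4 * (√6 * σ * √L) * √(D * T) = 4 * √6 * (σ * (√(D * T) * √L)) := by ring
    _ ≤ 10 * (σ * (√(D * T) * √L)) := by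
      gcongr
      linarith

/-- The finite-time bound, with a single numerical constant. -/
lemma integral_pseudoRegret_le_ten {Ω : Type*} {mΩ : MeasurableSpace Ω} {μ : Measure Ω}
    [IsProbabilityMeasure μ] {ℱ : Filtration ℕ mΩ} {d : ℕ} {𝒜 : ℕ → Finset (Fin d)}
    (h𝒜 : ∀ t, (𝒜 t).Nonempty) {p θ : Fin d → ℝ} {σ : ℝ≥0} {T : ℕ} {lam : ℝ}
    {arm : ℕ → Ω → Fin d} {x : ℕ → Ω → Bool} {ε : ℕ → Ω → ℝ}
    (hp : ∀ a, 0 < p a ∧ p a ≤ 1) (hlam : 0 < lam) (hT : 2 ≤ T)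
    (h : IsCensoredRun μ ℱ 𝒜 p σ T arm x ε) (hU : IsUCB 𝒜 θ σ lam T arm x ε) :
    ∫ ω, pseudoRegret 𝒜 h𝒜 θ T arm ω ∂μ ≤
      10 * (σ * √(effDim p * T * Real.log T) +
        effDim p * ‖θ‖ * (Real.log T + lam * Real.log (1 + T / lam))) := by
  have hD : (0 : ℝ) ≤ effDim p := (Nat.cast_nonneg d).trans (natCast_le_effDim hp)
  have h1 := integral_pseudoRegret_le (h𝒜 := h𝒜) hp hlam hT h hU
  have h2 := sqrt_bonus_le σ (L := Real.log T) hD T.cast_nonneg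
  have hlog : 4 ≤ 10 * Real.log T := by
    have : Real.log 2 ≤ Real.log T := Real.log_le_log two_pos (by exact_mod_cast hT)
    linarith [Real.log_two_gt_d9]
  have hl : 0 ≤ lam * Real.log (1 + T / lam) :=
    mul_nonneg hlam.le (Real.log_nonneg (le_add_of_nonneg_right (by positivity)))
  have h3 : effDim p * ‖θ‖ * (4 + 2 * (lam * Real.log (1 + T / lam))) ≤
      effDim p * ‖θ‖ * (10 * (Real.log T + lam * Real.log (1 + T / lam))) := by
    gcongr
    linarith
  linarith

/-! ### Large horizons -/

/-- The lower-order terms are negligible: `log (1 + y) ≤ 2 * √y` bounds `lam * log (1 + T / lam)`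
by `2 * √(lam * T)`, which is `o(√(T * log T))` as soon as `lam = o(log T)`. -/
lemma eventually_lowerOrder_le {lam : ℕ → ℝ} (hlam : ∀ T, 0 < lam T)
    (ho : lam =o[atTop] (fun T : ℕ ↦ Real.log T)) {c : ℝ} (hc : 0 < c) :
    ∀ᶠ T : ℕ in atTop, Real.log T + lam T * Real.log (1 + T / lam T) ≤
      c * √(T * Real.log T) := by
  have h1 := ho.bound (show 0 < (c / 4) ^ 2 by positivity)
  have h2 : ∀ᶠ T : ℕ in atTop, ‖Real.log T‖ ≤ (c / 2) ^ 2 * ‖(T : ℝ)‖ :=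
    (Real.isLittleO_log_id_atTop.comp_tendsto tendsto_natCast_atTop_atTop).bound
      (by positivity)
  filter_upwards [h1, h2] with T h1 h2
  have hL : 0 ≤ Real.log T := Real.log_natCast_nonneg T
  have hl := hlam T
  rw [Real.norm_of_nonneg hl.le, Real.norm_of_nonneg hL] at h1
  rw [Real.norm_of_nonneg hL, Real.norm_of_nonneg (by positivity)] at h2
  have e1 : Real.log T ≤ c / 2 * √(T * Real.log T) := by
    rw [← Real.sqrt_sq (show 0 ≤ c / 2 by positivity), ← Real.sqrt_mul (by positivity)]
    refine Real.le_sqrt_of_sq_le ?_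
    nlinarith
  have e2 : lam T * Real.log (1 + T / lam T) ≤ c / 2 * √(T * Real.log T) := by
    set y := √(T / lam T) with hy
    have hy0 : 0 ≤ y := Real.sqrt_nonneg _
    have hy2 : y ^ 2 = T / lam T := Real.sq_sqrt (by positivity)
    have hlog : Real.log (1 + T / lam T) ≤ 2 * y := by
      rw [← hy2]
      calc Real.log (1 + y ^ 2) ≤ Real.log ((1 + y) ^ 2) :=
            Real.log_le_log (by positivity) (by nlinarith)
        _ = 2 * Real.log (1 + y) := by rw [Real.log_pow]; norm_num
        _ ≤ 2 * y := by linarith [Real.log_le_sub_one_of_pos (show 0 < 1 + y by positivity)]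
    calc lam T * Real.log (1 + T / lam T) ≤ lam T * (2 * y) := by gcongr
      _ ≤ c / 2 * √(T * Real.log T) := by
        rw [← Real.sqrt_sq (show 0 ≤ c / 2 by positivity), ← Real.sqrt_mul (by positivity)]
        refine Real.le_sqrt_of_sq_le ?_
        have : (lam T * (2 * y)) ^ 2 = 4 * T * lam T := by
          rw [mul_pow, mul_pow, hy2]; field_simp; ring
        rw [this]
        nlinarith [mul_le_mul_of_nonneg_left h1 (show (0 : ℝ) ≤ 4 * T by positivity)]
  linarith

end CensoredBandit

theorem mainTheorem1 :
    ∃ C : ℝ, 0 < C ∧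
      -- finite-time bound, with explicit lower-order terms
      (∀ (d : ℕ) (p θ : Fin d → ℝ) (σ : ℝ≥0) (lam : ℝ) (T : ℕ)
        (𝒜 : ℕ → Finset (Fin d)) (h𝒜 : ∀ t, (𝒜 t).Nonempty)
        (Ω : Type*) [mΩ : MeasurableSpace Ω] (μ : Measure Ω) [IsProbabilityMeasure μ]
        (ℱ : Filtration ℕ mΩ)
        (arm : ℕ → Ω → Fin d) (x : ℕ → Ω → Bool) (ε : ℕ → Ω → ℝ),
        (∀ a, 0 < p a ∧ p a ≤ 1) → 0 < lam → 2 ≤ T →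
        CensoredBandit.IsCensoredRun μ ℱ 𝒜 p σ T arm x ε →
        CensoredBandit.IsUCB 𝒜 θ σ lam T arm x ε →
        ∫ ω, CensoredBandit.pseudoRegret 𝒜 h𝒜 θ T arm ω ∂μ ≤
          C * (σ * √(CensoredBandit.effDim p * T * Real.log T)
            + CensoredBandit.effDim p * ‖θ‖ * (Real.log T + lam * Real.log (1 + T / lam)))) ∧
      -- leading order for large horizons
      (∀ (σ : ℝ≥0) (lam : ℕ → ℝ) (M D : ℝ), 0 < σ → (∀ T, 0 < lam T) →
        lam =o[atTop] (fun T : ℕ ↦ Real.log T) →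
        ∃ T₀ : ℕ, ∀ T ≥ T₀, ∀ (d : ℕ) (p θ : Fin d → ℝ)
          (𝒜 : ℕ → Finset (Fin d)) (h𝒜 : ∀ t, (𝒜 t).Nonempty)
          (Ω : Type*) [mΩ : MeasurableSpace Ω] (μ : Measure Ω) [IsProbabilityMeasure μ]
          (ℱ : Filtration ℕ mΩ)
          (arm : ℕ → Ω → Fin d) (x : ℕ → Ω → Bool) (ε : ℕ → Ω → ℝ),
          (∀ a, 0 < p a ∧ p a ≤ 1) → CensoredBandit.effDim p ≤ D → ‖θ‖ ≤ M →
          CensoredBandit.IsCensoredRun μ ℱ 𝒜 p σ T arm x ε →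
          CensoredBandit.IsUCB 𝒜 θ σ (lam T) T arm x ε →
          ∫ ω, CensoredBandit.pseudoRegret 𝒜 h𝒜 θ T arm ω ∂μ ≤
            C * (σ * √(CensoredBandit.effDim p * T * Real.log T))) := by
  refine ⟨20, by norm_num, ?_, ?_⟩
  · intro d p θ σ lam T 𝒜 h𝒜 Ω mΩ μ _ ℱ arm x ε hp hlam hT h hU
    have hD : (0 : ℝ) ≤ CensoredBandit.effDim p :=
      (Nat.cast_nonneg d).trans (CensoredBandit.natCast_le_effDim hp)
    have hlog : 0 ≤ Real.log T := Real.log_natCast_nonneg T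
    have hl : 0 ≤ Real.log (1 + T / lam) :=
      Real.log_nonneg (le_add_of_nonneg_right (by positivity))
    refine (CensoredBandit.integral_pseudoRegret_le_ten h𝒜 hp hlam hT h hU).trans ?_
    gcongr
    norm_num
  · intro σ lam M D hσ hlam ho
    have hσ' : (0 : ℝ) < σ := hσ
    -- By `effDim p ≤ √D * √(effDim p)` the lower-order terms are eventually at most
    -- `√D * |M| * c * √(effDim p * T * log T)`; this choice of `c` keeps them below the
    -- leading term.
    set c : ℝ := σ / (√D * |M| + 1) with hc
    have hc0 : 0 < c := by positivity
    obtain ⟨T₀, hT₀⟩ := eventually_atTop.1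
      (CensoredBandit.eventually_lowerOrder_le hlam ho hc0)
    refine ⟨max T₀ 2, fun T hT d p θ 𝒜 h𝒜 Ω mΩ μ _ ℱ arm x ε hp hpD hθ h hU ↦ ?_⟩
    have hE : (0 : ℝ) ≤ CensoredBandit.effDim p :=
      (Nat.cast_nonneg d).trans (CensoredBandit.natCast_le_effDim hp)
    have h1 := CensoredBandit.integral_pseudoRegret_le_ten h𝒜 hp (hlam T)
      ((le_max_right _ _).trans hT) h hU
    have h2 := hT₀ T ((le_max_left _ _).trans hT)
    set E := CensoredBandit.effDim p
    have hlow : E * ‖θ‖ * (Real.log T + lam T * Real.log (1 + T / lam T)) ≤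
        σ * √(E * T * Real.log T) := by
      calc E * ‖θ‖ * (Real.log T + lam T * Real.log (1 + T / lam T))
          ≤ E * ‖θ‖ * (c * √(T * Real.log T)) := by gcongr
        _ = √E * ‖θ‖ * c * √(E * T * Real.log T) := by
            rw [mul_assoc E T, Real.sqrt_mul hE]
            nth_rw 1 [← Real.mul_self_sqrt hE]
            ring
        _ ≤ √D * |M| * c * √(E * T * Real.log T) := by
            gcongr
            exact hθ.trans (le_abs_self M)
        _ ≤ σ * √(E * T * Real.log T) := by
            gcongr
            rw [hc, mul_div_assoc', div_le_iff₀ (by positivity), mul_comm]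
            gcongr
            linarith
    linarith
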